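/- Let $d\ge 2$ and $k\ge 1$ be integers. A lattice polytope in $\mathbb{R}^d$ is a polytope all of whose vertices lie in $\mathbb{Z}^d$. Let $P\subset\mathbb{R}^d$ be a $d$-dimensional polytope with vertex set $\mathcal{V}$. A point $x\in\mathbb{R}^d\setminus P$ can be inserted in $P$ if the vertex set of $\mathrm{conv}(P\cup\{x\})$ is exactly $\mathcal{V}\cup\{x\}$; the insertion move then transforms $P$ into $\mathrm{conv}(P\cup\{x\})$. A vertex $v\in\mathcal{V}$ can be deleted from $P$ if $\mathrm{conv}(\mathcal{V}\setminus\{v\})$ is $d$-dimensional; the deletion move then transforms $P$ into $\mathrm{conv}(\mathcal{V}\setminus\{v\})$. Let $\Lambda(d,k)$ be the graph whose vertices are the $d$-dimensional lattice polytopes contained in the hypercube $[0,k]^d$ and whose edges connect two polytopes when one is obtained from the other by an insertion move or a deletion move. **Theorem.** The subgraph induced in $\Lambda(d,k)$ by the simplices and the polytopes with $d+2$ vertices is connected. -/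

import Mathlib

namespace ElementaryMoves

/-- A polytope in `ℝ^d`: the convex hull of a finite set of points. -/
def IsPolytope {d : ℕ} (P : Set (Fin d → ℝ)) : Prop :=
  ∃ s : Set (Fin d → ℝ), s.Finite ∧ P = convexHull ℝ s

/-- A subset of `ℝ^d` is `d`-dimensional when its affine hull is the whole space. -/
def IsFullDimensional {d : ℕ} (P : Set (Fin d → ℝ)) : Prop :=
  affineSpan ℝ P = ⊤

/-- The vertex set of a polytope: the set of its extreme points. -/
def vertexSet {d : ℕ} (P : Set (Fin d → ℝ)) : Set (Fin d → ℝ) :=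
  P.extremePoints ℝ

/-- The `d`-dimensional polytopes contained in `ℝ^d`. -/
def Polytope (d : ℕ) : Type :=
  {P : Set (Fin d → ℝ) // IsPolytope P ∧ IsFullDimensional P}

/-- The point `x` can be inserted in `P`: it lies outside of `P` and the vertices of the convex
hull of `P ∪ {x}` are exactly the vertices of `P` together with `x`. -/
def CanInsert {d : ℕ} (P : Set (Fin d → ℝ)) (x : Fin d → ℝ) : Prop :=
  x ∉ P ∧ vertexSet (convexHull ℝ (P ∪ {x})) = vertexSet P ∪ {x}

/-- The vertex `v` can be deleted from `P`: the convex hull of the other vertices of `P` is still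
`d`-dimensional. -/
def CanDelete {d : ℕ} (P : Set (Fin d → ℝ)) (v : Fin d → ℝ) : Prop :=
  v ∈ vertexSet P ∧ IsFullDimensional (convexHull ℝ (vertexSet P \ {v}))

/-- `Q` is obtained from `P` by an insertion move. -/
def IsInsertionMove {d : ℕ} (P Q : Set (Fin d → ℝ)) : Prop :=
  ∃ x, CanInsert P x ∧ Q = convexHull ℝ (P ∪ {x})

/-- `Q` is obtained from `P` by a deletion move. -/
def IsDeletionMove {d : ℕ} (P Q : Set (Fin d → ℝ)) : Prop :=
  ∃ v, CanDelete P v ∧ Q = convexHull ℝ (vertexSet P \ {v})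

/-- The graph `Γ(d)` on the `d`-dimensional polytopes of `ℝ^d`: two distinct polytopes are adjacent
when one is obtained from the other by an insertion move or a deletion move. -/
def moveGraph (d : ℕ) : SimpleGraph (Polytope d) :=
  SimpleGraph.fromRel fun P Q => IsInsertionMove P.1 Q.1 ∨ IsDeletionMove P.1 Q.1

/-- A lattice polytope: all the vertices belong to `ℤ^d`. -/
def IsLattice {d : ℕ} (P : Set (Fin d → ℝ)) : Prop :=
  ∀ v ∈ vertexSet P, ∀ i, ∃ z : ℤ, v i = z

/-- The hypercube `[0,k]^d`. -/
def cube (d k : ℕ) : Set (Fin d → ℝ) :=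
  {x | ∀ i, 0 ≤ x i ∧ x i ≤ k}

/-- The `d`-dimensional lattice polytopes contained in the hypercube `[0,k]^d`. -/
def latticePolytopesInCube (d k : ℕ) : Set (Polytope d) :=
  {P | IsLattice P.1 ∧ P.1 ⊆ cube d k}

/-- The graph `Λ(d,k)`: the subgraph induced in `Γ(d)` by the lattice polytopes contained in
`[0,k]^d`. -/
def latticeMoveGraph (d k : ℕ) : SimpleGraph (latticePolytopesInCube d k) :=
  (moveGraph d).induce (latticePolytopesInCube d k)

/-- A simplex: a polytope whose vertices are affinely independent. -/
def IsSimplex {d : ℕ} (P : Set (Fin d → ℝ)) : Prop :=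
  AffineIndependent ℝ (Subtype.val : vertexSet P → Fin d → ℝ)

end ElementaryMoves

/-!
Two simplices that differ in one vertex are linked as soon as the vertices of both are convexly
independent: the polytope with `d + 2` vertices that they span is a neighbour of each. Every vertex
of a simplex can be moved by such exchanges to a point lying on more facets of the cube, until all
the vertices are vertices of the cube. A move parallel to a coordinate axis suffices unless it
leads along an edge of the simplex or into the opposite face; the former case requires a detour
parallel to that edge, the latter a second move along another axis. As the vertices of the cube are
convexly independent, the simplices they span are linked by the basis exchange property.
-/

namespace ElementaryMoves

open Function Set Relation

section AffineBasis

variable {𝕜 E ι : Type*} [Field 𝕜] [AddCommGroup E] [Module 𝕜 E]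

theorem coord_add (b : AffineBasis ι 𝕜 E) (i : ι) (x u : E) :
    b.coord i (x + u) = b.coord i x + (b.coord i).linear u := by
  rw [add_comm, ← vadd_eq_add, AffineMap.map_vadd, vadd_eq_add, add_comm]

theorem linear_coord_sub (b : AffineBasis ι 𝕜 E) (i : ι) (x y : E) :
    (b.coord i).linear (x - y) = b.coord i x - b.coord i y :=
  (b.coord i).linearMap_vsub x y

theorem sum_linear_coord [Fintype ι] (b : AffineBasis ι 𝕜 E) (u : E) :
    ∑ i, (b.coord i).linear u = 0 := by
  have h := b.sum_coord_apply_eq_one (0 + u)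
  simpa only [coord_add, Finset.sum_add_distrib, b.sum_coord_apply_eq_one,
    add_eq_left] using h

theorem eq_of_linear_coord_eq [Finite ι] (b : AffineBasis ι 𝕜 E) {u v : E}
    (h : ∀ i, (b.coord i).linear u = (b.coord i).linear v) : u = v := by
  have : 0 + u = 0 + v := b.ext_elem fun i => by rw [coord_add, coord_add, h]
  simpa only [zero_add] using this

theorem sum_coord_mul_apply [Fintype ι] (b : AffineBasis ι 𝕜 E) (f : E →ᵃ[𝕜] 𝕜) (x : E) :
    ∑ i, b.coord i x * f (b i) = f x := by
  conv_rhs => rw [← b.affineCombination_coord_eq_self x,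
    Finset.map_affineCombination _ _ _ (b.sum_coord_apply_eq_one x),
    Finset.affineCombination_eq_linear_combination _ _ _ (b.sum_coord_apply_eq_one x)]
  simp only [comp_apply, smul_eq_mul]

theorem exists_coord_ne_zero_and_coord_ne_zero [Finite ι] (b c : AffineBasis ι 𝕜 E) (m : ι) :
    ∃ s, b.coord s (c m) ≠ 0 ∧ c.coord m (b s) ≠ 0 := by
  cases nonempty_fintype ι
  have hsum : ∑ s, b.coord s (c m) * c.coord m (b s) ≠ 0 := by
    rw [sum_coord_mul_apply, c.coord_apply_eq]
    exact one_ne_zero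
  obtain ⟨s, -, hs⟩ := Finset.exists_ne_zero_of_sum_ne_zero hsum
  exact ⟨s, mul_ne_zero_iff.1 hs⟩

theorem eq_smul_sub_of_linear_coord_eq_zero [Finite ι] (b : AffineBasis ι 𝕜 E) {s j : ι}
    (hjs : j ≠ s) {u : E} (h : ∀ m, m ≠ s → m ≠ j → (b.coord m).linear u = 0) :
    u = (b.coord j).linear u • (b j - b s) := by
  classical
  cases nonempty_fintype ι
  have hsum : (b.coord s).linear u + (b.coord j).linear u = 0 := by
    rw [← sum_linear_coord b u, Fintype.sum_eq_add s j hjs.symm fun m hm => h m hm.1 hm.2]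
  refine eq_of_linear_coord_eq b fun m => ?_
  rw [map_smul, linear_coord_sub, b.coord_apply, b.coord_apply, smul_eq_mul]
  rcases eq_or_ne m s with rfl | hms
  · rw [if_neg hjs.symm, if_pos rfl]
    linear_combination hsum
  rcases eq_or_ne m j with rfl | hmj
  · rw [if_pos rfl, if_neg hms, sub_zero, mul_one]
  · rw [if_neg hmj, if_neg hms, h m hms hmj, sub_zero, mul_zero]

theorem exists_affineBasis_eq_update [Finite ι] [DecidableEq ι] (b : AffineBasis ι 𝕜 E) {s : ι}
    {x : E} (h : b.coord s x ≠ 0) : ∃ b' : AffineBasis ι 𝕜 E, ⇑b' = update b s x := by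
  have hspan : affineSpan 𝕜 (b '' {i | i ≠ s}) ≤ (affineSpan 𝕜 {(0 : 𝕜)}).comap (b.coord s) := by
    rw [affineSpan_le]
    rintro _ ⟨i, hi, rfl⟩
    simp [b.coord_apply_ne (Ne.symm hi)]
  have hind := b.ind.affineIndependent_update_of_notMem_affineSpan
    (p₀ := x) (i := s) fun hx => h (by simpa using hspan hx)
  cases nonempty_fintype ι
  have := b.finiteDimensional
  exact ⟨⟨_, hind, (hind.affineSpan_eq_top_iff_card_eq_finrank_add_one).2
    b.card_eq_finrank_add_one⟩, rfl⟩

theorem exists_affineBasis_range_subset {n : ℕ} [FiniteDimensional 𝕜 E]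
    (hn : Module.finrank 𝕜 E = n) {V : Set E} (hV : affineSpan 𝕜 V = ⊤) :
    ∃ b : AffineBasis (Fin (n + 1)) 𝕜 E, range b ⊆ V := by
  obtain ⟨s, hs, b, hb⟩ := AffineBasis.exists_affine_subbasis hV
  have := b.finite
  have := Fintype.ofFinite s
  have hcard : Fintype.card s = n + 1 := hn ▸ b.card_eq_finrank_add_one
  refine ⟨b.reindex (Fintype.equivFinOfCardEq hcard), ?_⟩
  rwa [AffineBasis.coe_reindex, EquivLike.range_comp, hb, Subtype.range_coe]

theorem eq_of_subset_of_affineSpan_eq_top {V W : Set E}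
    (hV : AffineIndependent 𝕜 (Subtype.val : V → E)) (hWV : W ⊆ V) (hW : affineSpan 𝕜 W = ⊤) :
    W = V := by
  refine hWV.antisymm fun x hx => ?_
  have hx' := hV.mem_affineSpan_iff ⟨x, hx⟩ (Subtype.val ⁻¹' W)
  rw [Subtype.image_preimage_coe, inter_eq_right.2 hWV, hW] at hx'
  exact hx'.1 trivial

end AffineBasis

section Simplex

variable {𝕜 E ι : Type*} [Field 𝕜] [LinearOrder 𝕜] [AddCommGroup E] [Module 𝕜 E]

/-- The vector `u` points from the vertex `b s` into the cone spanned there by the simplex `b`. -/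
def PointsInto (b : AffineBasis ι 𝕜 E) (s : ι) (u : E) : Prop :=
  ∀ j ≠ s, 0 ≤ (b.coord j).linear u

theorem PointsInto.exists_linear_coord_pos [Finite ι] {b : AffineBasis ι 𝕜 E} {s : ι} {u : E}
    (h : PointsInto b s u) (hu : u ≠ 0) :
    ∃ j ≠ s, 0 < (b.coord j).linear u := by
  cases nonempty_fintype ι
  by_contra! hle
  have hzero : ∀ j ≠ s, (b.coord j).linear u = 0 := fun j hj => (hle j hj).antisymm (h j hj)
  have hs : (b.coord s).linear u = 0 := by
    rw [← sum_linear_coord b u, Fintype.sum_eq_single s hzero]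
  refine hu (eq_of_linear_coord_eq b fun j => ?_)
  rw [map_zero]
  rcases eq_or_ne j s with rfl | hj
  exacts [hs, hzero j hj]

variable [IsStrictOrderedRing 𝕜]

theorem PointsInto.linear_coord_neg [Finite ι] {b : AffineBasis ι 𝕜 E} {s : ι} {u : E}
    (h : PointsInto b s u) (hu : u ≠ 0) : (b.coord s).linear u < 0 := by
  classical
  cases nonempty_fintype ι
  obtain ⟨j, hjs, hj⟩ := h.exists_linear_coord_pos hu
  have hpos : 0 < ∑ i ∈ Finset.univ.erase s, (b.coord i).linear u :=
    Finset.sum_pos' (fun i hi => h i (Finset.ne_of_mem_erase hi)) ⟨j, by simp [hjs], hj⟩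
  have hsum := Finset.add_sum_erase _ (fun i => (b.coord i).linear u) (Finset.mem_univ s)
  rw [sum_linear_coord] at hsum
  linarith

theorem notMem_convexHull_of_pos {V : Set E} {x : E} (f : E →ᵃ[𝕜] 𝕜) (hx : 0 < f x)
    (hV : ∀ y ∈ V, f y ≤ 0) : x ∉ convexHull 𝕜 V := fun h =>
  hx.not_ge (convexHull_min hV ((convex_Iic (0 : 𝕜)).affine_preimage f) h)

theorem coord_apply_nonneg (b : AffineBasis ι 𝕜 E) (i j : ι) : 0 ≤ b.coord i (b j) := by
  classical
  rw [b.coord_apply]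
  split_ifs <;> simp

theorem apply_eq_of_coord_pos [Finite ι] (b : AffineBasis ι 𝕜 E) (f : E →ᵃ[𝕜] 𝕜) {x : E}
    (hf : ∀ i, f (b i) ≤ f x) (hx : ∀ i, 0 ≤ b.coord i x) {j : ι} (hj : 0 < b.coord j x) :
    f (b j) = f x := by
  cases nonempty_fintype ι
  have hsum : ∑ i, b.coord i x * (f x - f (b i)) = 0 := by
    simp only [mul_sub, Finset.sum_sub_distrib, ← Finset.sum_mul, b.sum_coord_apply_eq_one,
      sum_coord_mul_apply, one_mul, sub_self]
  have hzero := (Finset.sum_eq_zero_iff_of_nonneg fun i _ =>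
    mul_nonneg (hx i) (sub_nonneg.2 (hf i))).1 hsum j (Finset.mem_univ j)
  exact (sub_eq_zero.1 ((mul_eq_zero.1 hzero).resolve_left hj.ne')).symm

theorem notMem_range_of_coord_neg (b : AffineBasis ι 𝕜 E) {x : E} {l : ι}
    (hl : b.coord l x < 0) : x ∉ range b := by
  rintro ⟨m, rfl⟩
  exact hl.not_ge (coord_apply_nonneg b l m)

theorem convexIndependent_range (b : AffineBasis ι 𝕜 E) :
    ConvexIndependent 𝕜 (Subtype.val : range b → E) := by
  rw [convexIndependent_set_iff_notMem_convexHull_sdiff]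
  rintro _ ⟨i, rfl⟩
  refine notMem_convexHull_of_pos (b.coord i) (by simp) ?_
  rintro _ ⟨⟨j, rfl⟩, hj⟩
  have hij : i ≠ j := by
    rintro rfl
    exact hj rfl
  exact (b.coord_apply_ne hij).le

theorem convexIndependent_insert_range (b : AffineBasis ι 𝕜 E) {x : E} {i j l : ι} (hij : i ≠ j)
    (hi : 0 < b.coord i x) (hj : 0 < b.coord j x) (hl : b.coord l x < 0) :
    ConvexIndependent 𝕜 (Subtype.val : ↥(insert x (range b)) → E) := by
  rw [convexIndependent_set_iff_notMem_convexHull_sdiff]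
  rintro _ (rfl | ⟨m, rfl⟩)
  · refine notMem_convexHull_of_pos (-b.coord l) (neg_pos.2 hl) ?_
    rintro _ ⟨rfl | ⟨q, rfl⟩, hq⟩
    · exact absurd rfl hq
    · exact neg_nonpos.2 (coord_apply_nonneg b l q)
  · obtain ⟨n, hnm, hn⟩ : ∃ n, n ≠ m ∧ 0 < b.coord n x := by
      rcases eq_or_ne i m with rfl | him
      exacts [⟨j, hij.symm, hj⟩, ⟨i, him, hi⟩]
    -- The hyperplane `coord m = t * coord n` weakly separates `b m` from `x` and the other
    -- vertices.
    obtain ⟨t, ht, hxt⟩ : ∃ t, 0 ≤ t ∧ b.coord m x ≤ t * b.coord n x :=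
      ⟨max (b.coord m x / b.coord n x) 0, le_max_right _ _,
        (div_le_iff₀ hn).1 (le_max_left _ _)⟩
    refine notMem_convexHull_of_pos (b.coord m - t • b.coord n) ?_ ?_
    · simp [b.coord_apply_ne hnm]
    rintro _ ⟨rfl | ⟨q, rfl⟩, hq⟩
    · simpa using hxt
    · have hmq : m ≠ q := by
        rintro rfl
        exact hq rfl
      simpa [b.coord_apply_ne hmq] using mul_nonneg ht (coord_apply_nonneg b n q)

end Simplex

section Exchange

variable {𝕜 E ι : Type*} [Field 𝕜] [LinearOrder 𝕜] [AddCommGroup E] [Module 𝕜 E] [DecidableEq ι]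
  {G : Set E}

theorem range_update {α β : Type*} [DecidableEq α] {f : α → β} (hf : Injective f) (i : α) (x : β) :
    range (update f i x) = insert x (range f \ {f i}) := by
  ext y
  constructor
  · rintro ⟨j, rfl⟩
    rcases eq_or_ne j i with rfl | hj
    · exact .inl (update_self ..)
    · rw [update_of_ne hj]
      exact .inr ⟨⟨j, rfl⟩, hf.ne hj⟩
  · rintro (rfl | ⟨⟨j, rfl⟩, hj⟩)
    · exact ⟨i, update_self ..⟩
    · exact ⟨j, update_of_ne (ne_of_apply_ne f hj) ..⟩

/-- The simplex `b'` is obtained from the simplex `b` by inserting a point `x` of `G` and then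
deleting a vertex of `b`. Insertability of `x` is encoded as convex independence of `x` and the
vertices. -/
def Exchange (G : Set E) (b b' : AffineBasis ι 𝕜 E) : Prop :=
  ∃ x ∈ G, x ∉ range b ∧ ConvexIndependent 𝕜 (Subtype.val : ↥(insert x (range b)) → E) ∧
    ∃ s, ⇑b' = update b s x

theorem Exchange.range_subset {b b' : AffineBasis ι 𝕜 E} (h : Exchange G b b')
    (hb : range b ⊆ G) : range b' ⊆ G := by
  obtain ⟨x, hx, -, -, s, hb'⟩ := h
  rw [hb', range_update b.ind.injective]
  exact insert_subset hx (sdiff_subset.trans hb)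

theorem range_subset_of_reflTransGen_exchange {b b' : AffineBasis ι 𝕜 E}
    (h : ReflTransGen (Exchange G) b b') (hb : range b ⊆ G) : range b' ⊆ G := by
  induction h with
  | refl => exact hb
  | tail _ h ih => exact h.range_subset ih

theorem exists_exchange_diff_ssubset [Finite ι] {V : Set E}
    (hV : ConvexIndependent 𝕜 (Subtype.val : V → E)) (hVG : V ⊆ G) {b c : AffineBasis ι 𝕜 E}
    (hb : range b ⊆ V) (hc : range c ⊆ V) {m : ι} (hm : c m ∉ range b) :
    ∃ b' : AffineBasis ι 𝕜 E, Exchange G b b' ∧ range b' ⊆ V ∧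
      range c \ range b' ⊂ range c \ range b := by
  obtain ⟨s, hbs, hcs⟩ := exists_coord_ne_zero_and_coord_ne_zero b c m
  have hsc : b s ∉ range c := by
    rintro ⟨q, hq⟩
    have hqm : q ≠ m := by
      rintro rfl
      exact hm ⟨s, hq.symm⟩
    exact hcs (by rw [← hq, c.coord_apply_ne hqm.symm])
  obtain ⟨b', hb'⟩ := exists_affineBasis_eq_update b hbs
  have hcm : c m ∈ V := hc ⟨m, rfl⟩
  refine ⟨b', ⟨c m, hVG hcm, hm, hV.mono (insert_subset hcm hb), s, hb'⟩, ?_, ?_⟩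
  · rw [hb', range_update b.ind.injective]
    exact insert_subset hcm (sdiff_subset.trans hb)
  refine (ssubset_iff_of_subset ?_).2 ⟨c m, ⟨⟨m, rfl⟩, hm⟩, fun h => h.2 ⟨s, by simp [hb']⟩⟩
  rintro y ⟨hy, hyb'⟩
  refine ⟨hy, ?_⟩
  rintro ⟨q, rfl⟩
  have hqs : q ≠ s := by
    rintro rfl
    exact hsc hy
  exact hyb' ⟨q, by rw [hb', update_of_ne hqs]⟩

theorem exists_reflTransGen_exchange_range_eq [Finite ι] {V : Set E}
    (hV : ConvexIndependent 𝕜 (Subtype.val : V → E)) (hVG : V ⊆ G) (b c : AffineBasis ι 𝕜 E)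
    (hb : range b ⊆ V) (hc : range c ⊆ V) :
    ∃ b' : AffineBasis ι 𝕜 E, range b' = range c ∧ ReflTransGen (Exchange G) b b' := by
  induction hn : (range c \ range b).ncard using Nat.strong_induction_on generalizing b with
  | h n ih =>
    by_cases hcb : range c ⊆ range b
    · refine ⟨b, (eq_of_subset_of_ncard_le hcb ?_).symm, .refl⟩
      rw [ncard_range_of_injective b.ind.injective, ncard_range_of_injective c.ind.injective]
    · obtain ⟨_, ⟨m, rfl⟩, hm⟩ := not_subset.1 hcb
      obtain ⟨b₁, hbb₁, hb₁, hlt⟩ := exists_exchange_diff_ssubset hV hVG hb hc hm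
      obtain ⟨b', hb', h⟩ := ih _ (hn ▸ ncard_lt_ncard hlt) b₁ hb₁ rfl
      exact ⟨b', hb', .head hbb₁ h⟩

variable [IsStrictOrderedRing 𝕜] [Finite ι]

theorem exists_exchange (b : AffineBasis ι 𝕜 E) {x : E} (hx : x ∈ G) {s i j l : ι}
    (hs : b.coord s x ≠ 0) (hij : i ≠ j) (hi : 0 < b.coord i x) (hj : 0 < b.coord j x)
    (hl : b.coord l x < 0) : ∃ b' : AffineBasis ι 𝕜 E, ⇑b' = update b s x ∧ Exchange G b b' := by
  obtain ⟨b', hb'⟩ := exists_affineBasis_eq_update b hs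
  exact ⟨b', hb', x, hx, notMem_range_of_coord_neg b hl,
    convexIndependent_insert_range b hij hi hj hl, s, hb'⟩

theorem exists_exchange_add_smul_sub (b : AffineBasis ι 𝕜 E) {s j r : ι} (hjs : j ≠ s)
    (hrs : r ≠ s) (hrj : r ≠ j) {t : 𝕜} (ht : t ≠ 0) (hx : b r + t • (b s - b j) ∈ G) :
    ∃ b' : AffineBasis ι 𝕜 E, ⇑b' = update b s (b r + t • (b s - b j)) ∧ Exchange G b b' := by
  have hcoord (m : ι) : b.coord m (b r + t • (b s - b j)) =
      b.coord m (b r) + t * (b.coord m (b s) - b.coord m (b j)) := by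
    rw [coord_add, map_smul, linear_coord_sub, smul_eq_mul]
  have hr : b.coord r (b r + t • (b s - b j)) = 1 := by
    simp [hcoord, b.coord_apply_ne hrs, b.coord_apply_ne hrj]
  have hs : b.coord s (b r + t • (b s - b j)) = t := by
    simp [hcoord, b.coord_apply_ne hrs.symm, b.coord_apply_ne hjs.symm]
  have hj : b.coord j (b r + t • (b s - b j)) = -t := by
    simp [hcoord, b.coord_apply_ne hrj.symm, b.coord_apply_ne hjs]
  have hr' : 0 < b.coord r (b r + t • (b s - b j)) := hr.symm ▸ one_pos
  have hs' : b.coord s (b r + t • (b s - b j)) ≠ 0 := hs.symm ▸ ht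
  rcases ht.lt_or_gt with ht | ht
  · exact exists_exchange b hx hs' hrj hr' (by rwa [hj, neg_pos]) (by rwa [hs])
  · exact exists_exchange b hx hs' hrs hr' (by rwa [hs]) (by rwa [hj, neg_lt_zero])

/-- The vertex `b s` cannot be pushed directly along its edge to `b j`: it makes a detour through
the parallel line passing by a third vertex `b r`. -/
theorem exists_reflTransGen_exchange_of_parallel (b : AffineBasis ι 𝕜 E) {s j r : ι}
    (hjs : j ≠ s) (hrs : r ≠ s) (hrj : r ≠ j) {e : E} {α β γ : 𝕜} (hβ : β ≠ 0) (hγ : γ ≠ 0)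
    (hsj : b s - b j = α • e) (hr : b r + β • e ∈ G) (hj : b j + γ • e ∈ G) :
    ∃ b' : AffineBasis ι 𝕜 E, ⇑b' = update b s (b j + γ • e) ∧
      ReflTransGen (Exchange G) b b' := by
  have hα : α ≠ 0 := by
    rintro rfl
    exact hjs (b.ind.injective (sub_eq_zero.1 (hsj.trans (zero_smul 𝕜 e))).symm)
  have hr' : b r + (β / α) • (b s - b j) = b r + β • e := by
    rw [hsj, smul_smul, div_mul_cancel₀ _ hα]
  obtain ⟨b₁, hb₁, h₁⟩ := exists_exchange_add_smul_sub (G := G) b hjs hrs hrj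
    (div_ne_zero hβ hα) (hr' ▸ hr)
  rw [hr'] at hb₁
  have hj' : b₁ j + (γ / β) • (b₁ s - b₁ r) = b j + γ • e := by
    rw [hb₁, update_self, update_of_ne hjs, update_of_ne hrs, add_sub_cancel_left, smul_smul,
      div_mul_cancel₀ _ hβ]
  obtain ⟨b₂, hb₂, h₂⟩ := exists_exchange_add_smul_sub (G := G) b₁ hrs hjs hrj.symm
    (div_ne_zero hγ hβ) (hj' ▸ hj)
  exact ⟨b₂, by rw [hb₂, hj', hb₁, update_idem], .head h₁ (.single h₂)⟩

end Exchange

section Grid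

variable {α κ : Type*}

/-- The coordinates in which `x` lies on a wall of the box `Icc lo hi`. -/
def wallCoords (lo hi x : κ → α) : Set κ :=
  {i | x i ∈ ({lo i, hi i} : Set α)}

/-- The vertices of the box `Icc lo hi`. -/
def corners (lo hi : κ → α) : Set (κ → α) :=
  univ.pi fun i => {lo i, hi i}

variable [DecidableEq κ] {lo hi x : κ → α} {i : κ} {c : α}

theorem wallCoords_ssubset_update (hx : i ∉ wallCoords lo hi x)
    (hc : c ∈ ({lo i, hi i} : Set α)) :
    wallCoords lo hi x ⊂ wallCoords lo hi (update x i c) := by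
  refine (ssubset_iff_of_subset fun l hl => ?_).2 ⟨i, by simpa [wallCoords] using hc, hx⟩
  have hli : l ≠ i := by
    rintro rfl
    exact hx hl
  simpa [wallCoords, hli] using hl

variable [LinearOrder α]

/-- A nonempty set of points of the box `Icc lo hi` that is stable under moving a point, parallel to
a coordinate axis, onto a wall of the box. The lattice points of a cube are the motivating example.
-/
structure IsBoxGrid (lo hi : κ → α) (G : Set (κ → α)) : Prop where
  lt : ∀ i, lo i < hi i
  nonempty : G.Nonempty
  subset_Icc : G ⊆ Icc lo hi
  update_mem : ∀ ⦃x⦄, x ∈ G → ∀ i, ∀ c ∈ ({lo i, hi i} : Set α), update x i c ∈ G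

variable {G : Set (κ → α)}

theorem IsBoxGrid.exists_wall_ne (hG : IsBoxGrid lo hi G) (i : κ) (t : α) :
    ∃ c ∈ ({lo i, hi i} : Set α), c ≠ t := by
  rcases eq_or_ne (lo i) t with rfl | h
  exacts [⟨hi i, by simp, (hG.lt i).ne'⟩, ⟨lo i, by simp, h⟩]

theorem IsBoxGrid.corners_subset [Finite κ] (hG : IsBoxGrid lo hi G) : corners lo hi ⊆ G := by
  intro y hy
  cases nonempty_fintype κ
  obtain ⟨x, hx⟩ := hG.nonempty
  have hmem (s : Finset κ) : s.piecewise y x ∈ G := by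
    induction s using Finset.induction with
    | empty => simpa using hx
    | insert i s _ ih =>
      rw [Finset.piecewise_insert]
      exact hG.update_mem ih i _ (hy i trivial)
  simpa using hmem Finset.univ

end Grid

section Pi

variable {𝕜 κ ι : Type*} [Field 𝕜] [DecidableEq κ]

theorem add_single_sub (x : κ → 𝕜) (i : κ) (c : 𝕜) : x + Pi.single i (c - x i) = update x i c := by
  ext l
  rcases eq_or_ne l i with rfl | hl <;> simp [*]

theorem smul_single_one (i : κ) (t : 𝕜) : t • Pi.single i (1 : 𝕜) = (Pi.single i t : κ → 𝕜) := by
  rw [← Pi.single_smul, smul_eq_mul, mul_one]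

theorem coord_update (b : AffineBasis ι 𝕜 (κ → 𝕜)) (j : ι) (x : κ → 𝕜) (i : κ) (c : 𝕜) :
    b.coord j (update x i c) = b.coord j x + (b.coord j).linear (Pi.single i (c - x i)) := by
  rw [← add_single_sub, coord_add]

theorem linear_coord_single (b : AffineBasis ι 𝕜 (κ → 𝕜)) (j : ι) (i : κ) (t : 𝕜) :
    (b.coord j).linear (Pi.single i t) = t * (b.coord j).linear (Pi.single i 1) := by
  rw [← smul_single_one, map_smul, smul_eq_mul]

end Pi

section Improvement

variable {𝕜 κ ι : Type*} [Field 𝕜] [LinearOrder 𝕜] [IsStrictOrderedRing 𝕜]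
  {lo hi : κ → 𝕜} {G : Set (κ → 𝕜)} {b : AffineBasis ι 𝕜 (κ → 𝕜)} {s : ι}

theorem exists_wall_mul_neg {x : κ → 𝕜} (hx : x ∈ Icc lo hi) {i : κ}
    (hxi : i ∉ wallCoords lo hi x) (t : 𝕜) :
    ∃ c ∈ ({lo i, hi i} : Set 𝕜), ∃ c' ∈ ({lo i, hi i} : Set 𝕜),
      (c - x i) * (c' - x i) < 0 ∧ 0 ≤ (c - x i) * t := by
  have hlo : lo i - x i < 0 := sub_neg.2 ((hx.1 i).lt_of_ne fun h => hxi (Or.inl h.symm))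
  have hhi : 0 < hi i - x i := sub_pos.2 ((hx.2 i).lt_of_ne fun h => hxi (Or.inr h))
  rcases le_total 0 t with ht | ht
  · exact ⟨hi i, by simp, lo i, by simp, mul_neg_of_pos_of_neg hhi hlo, mul_nonneg hhi.le ht⟩
  · exact ⟨lo i, by simp, hi i, by simp, mul_neg_of_neg_of_pos hlo hhi,
      mul_nonneg_of_nonpos_of_nonpos hlo.le ht⟩

theorem apply_eq_of_mem_wallCoords [Finite ι] (hb : range b ⊆ Icc lo hi) {x : κ → 𝕜}
    (hx : ∀ m, 0 ≤ b.coord m x) {i : κ} (hxi : i ∈ wallCoords lo hi x) {j : ι}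
    (hj : 0 < b.coord j x) : b j i = x i := by
  let f : (κ → 𝕜) →ᵃ[𝕜] 𝕜 := (LinearMap.proj i).toAffineMap
  have hbm (m : ι) : b m ∈ Icc lo hi := hb ⟨m, rfl⟩
  rcases hxi with hxi | hxi
  · exact neg_injective <| apply_eq_of_coord_pos b (-f)
      (fun m => neg_le_neg (hxi.trans_le ((hbm m).1 i))) hx hj
  · exact apply_eq_of_coord_pos b f (fun m => ((hbm m).2 i).trans_eq hxi.symm) hx hj

theorem exists_notMem_wallCoords [Finite ι] (hb : range b ⊆ Icc lo hi) {x : κ → 𝕜}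
    (hx : ∀ m, 0 ≤ b.coord m x) {j j' : ι} (hjj' : j ≠ j') (hj : 0 < b.coord j x)
    (hj' : 0 < b.coord j' x) : ∃ i, i ∉ wallCoords lo hi x := by
  by_contra! hall
  refine hjj' (b.ind.injective (funext fun i => ?_))
  rw [apply_eq_of_mem_wallCoords hb hx (hall i) hj, apply_eq_of_mem_wallCoords hb hx (hall i) hj']

variable [DecidableEq ι]

/-- In the simplex `b`, the vertex `b s` can be replaced by a point lying on more walls of the box,
by a sequence of exchanges through points of `G`. -/
def Improvable (lo hi : κ → 𝕜) (G : Set (κ → 𝕜)) (b : AffineBasis ι 𝕜 (κ → 𝕜)) (s : ι) : Prop :=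
  ∃ (x : κ → 𝕜) (b' : AffineBasis ι 𝕜 (κ → 𝕜)), wallCoords lo hi (b s) ⊂ wallCoords lo hi x ∧
    ⇑b' = update b s x ∧ ReflTransGen (Exchange G) b b'

theorem improvable_of_coord [Finite ι] {x : κ → 𝕜} (hx : x ∈ G)
    (hwall : wallCoords lo hi (b s) ⊂ wallCoords lo hi x) (hs : b.coord s x ≠ 0) {j j' l : ι}
    (hjj' : j ≠ j') (hj : 0 < b.coord j x) (hj' : 0 < b.coord j' x) (hl : b.coord l x < 0) :
    Improvable lo hi G b s := by
  obtain ⟨b', hb', h⟩ := exists_exchange b hx hs hjj' hj hj' hl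
  exact ⟨x, b', hwall, hb', .single h⟩

variable [DecidableEq κ] [Finite ι] {i : κ}

/-- If neither of the two opposite moves of `b s` along the axis `i` points into the simplex, then
the barycentric coordinates of vertices other than `b s` decrease in both directions, and one of the
two moves also increases that of `b s`. -/
theorem improvable_or_exists_pointsInto (hG : IsBoxGrid lo hi G) (hb : range b ⊆ G)
    (hsi : i ∉ wallCoords lo hi (b s)) :
    Improvable lo hi G b s ∨
      ∃ c ∈ ({lo i, hi i} : Set 𝕜), PointsInto b s (Pi.single i (c - b s i)) := by
  have hbs : b s ∈ G := hb ⟨s, rfl⟩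
  obtain ⟨c, hc, c', hc', hcc', hcs⟩ := exists_wall_mul_neg (hG.subset_Icc hbs) hsi
    ((b.coord s).linear (Pi.single i 1))
  by_cases h : PointsInto b s (Pi.single i (c - b s i))
  · exact Or.inr ⟨c, hc, h⟩
  by_cases h' : PointsInto b s (Pi.single i (c' - b s i))
  · exact Or.inr ⟨c', hc', h'⟩
  simp only [PointsInto, not_forall, not_le] at h h'
  obtain ⟨l, hls, hl⟩ := h
  obtain ⟨j, hjs, hj⟩ := h'
  have hj' : 0 < (b.coord j).linear (Pi.single i (c - b s i)) := by
    rw [linear_coord_single] at hj ⊢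
    nlinarith [mul_pos_of_neg_of_neg hcc' hj, sq_nonneg (c' - b s i)]
  refine Or.inl (improvable_of_coord (hG.update_mem hbs i c hc) (wallCoords_ssubset_update hsi hc)
    (j := s) (j' := j) (l := l) (ne_of_gt ?_) hjs.symm ?_ ?_ ?_)
  · rw [coord_update, b.coord_apply_eq, linear_coord_single]
    linarith
  · rw [coord_update, b.coord_apply_eq, linear_coord_single]
    linarith
  · rwa [coord_update, b.coord_apply_ne hjs, zero_add]
  · rwa [coord_update, b.coord_apply_ne hls, zero_add]

/-- Here `x`, the new position of `b s`, lies in the face opposite to `b s`, where it cannot be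
inserted; a further move along an axis in which `x` is free pushes it beyond that face. -/
theorem improvable_of_coord_eq_zero (hG : IsBoxGrid lo hi G) (hb : range b ⊆ G) {x : κ → 𝕜}
    (hxG : x ∈ G) (hwall : wallCoords lo hi (b s) ⊂ wallCoords lo hi x)
    (hfree : ∀ l ∉ wallCoords lo hi x, x l = b s l) (hnonneg : ∀ m, 0 ≤ b.coord m x)
    (hs : b.coord s x = 0) {j j' : ι} (hjj' : j ≠ j') (hj : 0 < b.coord j x)
    (hj' : 0 < b.coord j' x) : Improvable lo hi G b s := by
  obtain ⟨l, hl⟩ := exists_notMem_wallCoords (hb.trans hG.subset_Icc) hnonneg hjj' hj hj'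
  have hsl : l ∉ wallCoords lo hi (b s) := fun h => hl (hwall.subset h)
  rcases improvable_or_exists_pointsInto hG hb hsl with h | ⟨c, hc, hin⟩
  · exact h
  have hne : (Pi.single l (c - b s l) : κ → 𝕜) ≠ 0 := by
    rw [Ne, Pi.single_eq_zero_iff, sub_eq_zero]
    rintro rfl
    exact hsl hc
  have hcoord (m : ι) : b.coord m (update x l c) =
      b.coord m x + (b.coord m).linear (Pi.single l (c - b s l)) := by
    rw [coord_update, hfree l hl]
  have hneg : b.coord s (update x l c) < 0 := by
    rw [hcoord, hs, zero_add]
    exact hin.linear_coord_neg hne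
  have hpos {m : ι} (hm : 0 < b.coord m x) : 0 < b.coord m (update x l c) := by
    have hms : m ≠ s := by
      rintro rfl
      exact hm.ne' hs
    rw [hcoord]
    exact add_pos_of_pos_of_nonneg hm (hin m hms)
  exact improvable_of_coord (hG.update_mem hxG l c hc)
    (hwall.trans (wallCoords_ssubset_update hl hc)) hneg.ne hjj' (hpos hj) (hpos hj') hneg

theorem improvable_of_pointsInto_of_two_pos (hG : IsBoxGrid lo hi G) (hb : range b ⊆ G)
    (hsi : i ∉ wallCoords lo hi (b s)) {c : 𝕜} (hc : c ∈ ({lo i, hi i} : Set 𝕜))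
    (hin : PointsInto b s (Pi.single i (c - b s i))) {j j' : ι} (hjj' : j ≠ j') (hjs : j ≠ s)
    (hj's : j' ≠ s) (hj : 0 < (b.coord j).linear (Pi.single i (c - b s i)))
    (hj' : 0 < (b.coord j').linear (Pi.single i (c - b s i))) :
    Improvable lo hi G b s := by
  set x := update (b s) i c with hxdef
  have hxG : x ∈ G := hG.update_mem (hb ⟨s, rfl⟩) i c hc
  have hwall : wallCoords lo hi (b s) ⊂ wallCoords lo hi x := wallCoords_ssubset_update hsi hc
  have hcoord {m : ι} (hm : m ≠ s) :
      b.coord m x = (b.coord m).linear (Pi.single i (c - b s i)) := by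
    rw [coord_update, b.coord_apply_ne hm, zero_add]
  rw [← hcoord hjs] at hj
  rw [← hcoord hj's] at hj'
  rcases lt_or_ge (b.coord s x) 0 with hs | hs
  · exact improvable_of_coord hxG hwall hs.ne hjj' hj hj' hs
  have hnonneg (m : ι) : 0 ≤ b.coord m x := by
    rcases eq_or_ne m s with rfl | hm
    exacts [hs, hcoord hm ▸ hin m hm]
  have hxi : x i ∈ ({lo i, hi i} : Set 𝕜) := by rwa [hxdef, update_self]
  have hsi' : b s i ≠ x i := fun h => hsi (by rwa [wallCoords, mem_ofPred_eq, h])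
  have hs0 : b.coord s x = 0 := hs.antisymm' <| not_lt.1 fun hpos => hsi' <|
    apply_eq_of_mem_wallCoords (hb.trans hG.subset_Icc) hnonneg hxi hpos
  refine improvable_of_coord_eq_zero hG hb hxG hwall (fun l hl => update_of_ne ?_ ..) hnonneg hs0
    hjj' hj hj'
  rintro rfl
  exact hl hxi

theorem improvable_of_linear_coord_eq_zero (hι : 3 ≤ ENat.card ι) (hG : IsBoxGrid lo hi G)
    (hb : range b ⊆ G) (hsi : i ∉ wallCoords lo hi (b s)) {j : ι} (hjs : j ≠ s)
    (hpar : ∀ m, m ≠ s → m ≠ j → (b.coord m).linear (Pi.single i 1) = 0) :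
    Improvable lo hi G b s := by
  obtain ⟨r, hrs, hrj⟩ := ENat.exists_ne_ne_of_three_le hι s j
  obtain ⟨β, hβ, hβr⟩ := hG.exists_wall_ne i (b r i)
  obtain ⟨γ, hγ, hγj⟩ := hG.exists_wall_ne i (b j i)
  have hedge := eq_smul_sub_of_linear_coord_eq_zero b hjs hpar
  have hτ : (b.coord j).linear (Pi.single i 1) ≠ 0 := by
    rintro h
    rw [h, zero_smul, Pi.single_eq_zero_iff] at hedge
    exact one_ne_zero hedge
  have hsj : b s - b j = (-((b.coord j).linear (Pi.single i 1))⁻¹) • Pi.single i 1 := by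
    rw [neg_smul, ← neg_sub, neg_inj, eq_inv_smul_iff₀ hτ, ← hedge]
  have hmove (m : ι) (c : 𝕜) : b m + (c - b m i) • Pi.single i 1 = update (b m) i c := by
    rw [smul_single_one, add_single_sub]
  obtain ⟨b', hb', h⟩ := exists_reflTransGen_exchange_of_parallel (G := G) b hjs hrs hrj
    (sub_ne_zero.2 hβr) (sub_ne_zero.2 hγj) hsj (hmove r β ▸ hG.update_mem (hb ⟨r, rfl⟩) i β hβ)
    (hmove j γ ▸ hG.update_mem (hb ⟨j, rfl⟩) i γ hγ)
  refine ⟨update (b s) i γ, b', wallCoords_ssubset_update hsi hγ, ?_, h⟩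
  have hsame : update (b j) i γ = update (b s) i γ := by
    ext l
    rcases eq_or_ne l i with rfl | hl
    · rw [update_self, update_self]
    · have hl' : b s l - b j l = 0 := by simpa [hl] using congrFun hsj l
      rw [update_of_ne hl, update_of_ne hl, sub_eq_zero.1 hl']
  rw [hb', hmove, hsame]

theorem improvable_of_notMem_wallCoords (hι : 3 ≤ ENat.card ι) (hG : IsBoxGrid lo hi G)
    (hb : range b ⊆ G) (hsi : i ∉ wallCoords lo hi (b s)) : Improvable lo hi G b s := by
  rcases improvable_or_exists_pointsInto hG hb hsi with h | ⟨c, hc, hin⟩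
  · exact h
  have hc0 : c - b s i ≠ 0 := by
    rw [sub_ne_zero]
    rintro rfl
    exact hsi hc
  obtain ⟨j, hjs, hj⟩ := hin.exists_linear_coord_pos (by rwa [Ne, Pi.single_eq_zero_iff])
  by_cases h : ∃ j', j' ≠ s ∧ j' ≠ j ∧ 0 < (b.coord j').linear (Pi.single i (c - b s i))
  · obtain ⟨j', hj's, hj'j, hj'⟩ := h
    exact improvable_of_pointsInto_of_two_pos hG hb hsi hc hin hj'j hj's hjs hj' hj
  · push Not at h
    refine improvable_of_linear_coord_eq_zero hι hG hb hsi hjs fun m hms hmj => ?_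
    have hm := (h m hms hmj).antisymm (hin m hms)
    rw [linear_coord_single] at hm
    exact (mul_eq_zero.1 hm).resolve_left hc0

theorem exists_reflTransGen_range_subset_corners [Finite κ] (hι : 3 ≤ ENat.card ι)
    (hG : IsBoxGrid lo hi G) (b : AffineBasis ι 𝕜 (κ → 𝕜)) (hb : range b ⊆ G) :
    ∃ b' : AffineBasis ι 𝕜 (κ → 𝕜), range b' ⊆ corners lo hi ∧ ReflTransGen (Exchange G) b b' := by
  induction hn : {q : ι × κ | q.2 ∉ wallCoords lo hi (b q.1)}.ncard using Nat.strong_induction_on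
    generalizing b with
  | h n ih =>
    by_cases hwall : ∀ s i, i ∈ wallCoords lo hi (b s)
    · refine ⟨b, ?_, .refl⟩
      rintro _ ⟨s, rfl⟩ i -
      exact hwall s i
    push Not at hwall
    obtain ⟨s, i, hsi⟩ := hwall
    obtain ⟨x, b₁, hx, hb₁, h₁⟩ := improvable_of_notMem_wallCoords hι hG hb hsi
    have hlt : {q : ι × κ | q.2 ∉ wallCoords lo hi (b₁ q.1)} ⊂
        {q : ι × κ | q.2 ∉ wallCoords lo hi (b q.1)} := by
      obtain ⟨l, hlx, hl⟩ := exists_of_ssubset hx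
      refine (ssubset_iff_of_subset ?_).2 ⟨(s, l), hl, by simpa [hb₁] using hlx⟩
      rintro ⟨m, l⟩ hm hml
      rcases eq_or_ne m s with rfl | hms
      · exact hm (by simpa [hb₁] using hx.subset hml)
      · exact hm (by simpa [hb₁, hms] using hml)
    obtain ⟨b', hb', h'⟩ := ih _ (hn ▸ ncard_lt_ncard hlt) b₁
      (range_subset_of_reflTransGen_exchange h₁ hb) rfl
    exact ⟨b', hb', h₁.trans h'⟩

end Improvement

section Corners

variable {κ : Type*} {lo hi : κ → ℝ}

theorem convexIndependent_corners (h : lo ≤ hi) :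
    ConvexIndependent ℝ (Subtype.val : corners lo hi → κ → ℝ) := by
  have hcorners : corners lo hi = (Icc lo hi).extremePoints ℝ := by
    rw [← pi_univ_Icc, extremePoints_pi]
    exact congrArg (univ.pi ·) (funext fun i => (Set.extremePoints_Icc (h i)).symm)
  rw [hcorners]
  exact (convex_Icc lo hi).convexIndependent_extremePoints

theorem affineSpan_corners [Finite κ] (h : ∀ i, lo i < hi i) :
    affineSpan ℝ (corners lo hi) = ⊤ := by
  cases nonempty_fintype κ
  rw [← interior_convexHull_nonempty_iff_affineSpan_eq_top, corners, convexHull_pi,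
    interior_pi_set finite_univ, univ_pi_nonempty_iff]
  intro i
  rw [convexHull_pair, segment_eq_Icc (h i).le, interior_Icc]
  exact nonempty_Ioo.2 (h i)

end Corners

section Polytope

variable {d : ℕ} {P V G : Set (Fin d → ℝ)}

theorem finite_vertexSet (hP : IsPolytope P) : (vertexSet P).Finite := by
  obtain ⟨s, hs, rfl⟩ := hP
  exact hs.subset extremePoints_convexHull_subset

theorem convexHull_vertexSet (hP : IsPolytope P) : convexHull ℝ (vertexSet P) = P := by
  have hclosed := (finite_vertexSet hP).isClosed_convexHull ℝ
  obtain ⟨s, hs, rfl⟩ := hP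
  exact hclosed.closure_eq.symm.trans
    (closure_convexHull_extremePoints (hs.isCompact_convexHull ℝ) (convex_convexHull ℝ s))

theorem convexIndependent_vertexSet (hP : IsPolytope P) :
    ConvexIndependent ℝ (Subtype.val : vertexSet P → Fin d → ℝ) := by
  obtain ⟨s, -, rfl⟩ := hP
  exact (convex_convexHull ℝ s).convexIndependent_extremePoints

theorem vertexSet_convexHull (hV : V.Finite)
    (hind : ConvexIndependent ℝ (Subtype.val : V → Fin d → ℝ)) :
    vertexSet (convexHull ℝ V) = V := by
  refine extremePoints_convexHull_subset.antisymm fun x hx => ?_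
  refine convexIndependent_set_iff_inter_convexHull_subset.1 hind _
    extremePoints_convexHull_subset ⟨hx, ?_⟩
  exact (convexHull_vertexSet ⟨V, hV, rfl⟩).symm ▸ subset_convexHull ℝ V hx

/-- The polytopes all of whose vertices belong to `G`. -/
def polytopesOn (G : Set (Fin d → ℝ)) : Set (Polytope d) :=
  {P | vertexSet P.1 ⊆ G}

/-- The simplices and the polytopes with `d + 2` vertices, among the polytopes with vertices in
`G`. -/
def smallPolytopes (G : Set (Fin d → ℝ)) : Set (polytopesOn G) :=
  {P | IsSimplex P.1.1 ∨ (vertexSet P.1.1).ncard = d + 2}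

/-- The graph of insertion and deletion moves between the members of `smallPolytopes G`. -/
def smallPolytopeGraph (G : Set (Fin d → ℝ)) : SimpleGraph (smallPolytopes G) :=
  ((moveGraph d).induce (polytopesOn G)).induce (smallPolytopes G)

theorem exists_smallPolytope (hfin : V.Finite)
    (hind : ConvexIndependent ℝ (Subtype.val : V → Fin d → ℝ)) (hVG : V ⊆ G)
    (hspan : affineSpan ℝ V = ⊤)
    (h : AffineIndependent ℝ (Subtype.val : V → Fin d → ℝ) ∨ V.ncard = d + 2) :
    ∃ P : smallPolytopes G, P.1.1.1 = convexHull ℝ V := by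
  have hvert := vertexSet_convexHull hfin hind
  refine ⟨⟨⟨⟨convexHull ℝ V, ⟨V, hfin, rfl⟩, ?_⟩, ?_⟩, ?_⟩, rfl⟩
  · rwa [IsFullDimensional, affineSpan_convexHull]
  · exact hvert.trans_subset hVG
  · change IsSimplex (convexHull ℝ V) ∨ (vertexSet (convexHull ℝ V)).ncard = d + 2
    rwa [IsSimplex, hvert]

theorem exists_smallPolytope_eq_convexHull_range (b : AffineBasis (Fin (d + 1)) ℝ (Fin d → ℝ))
    (hb : range b ⊆ G) : ∃ P : smallPolytopes G, P.1.1.1 = convexHull ℝ (range b) :=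
  exists_smallPolytope (finite_range b) (convexIndependent_range b) hb b.tot (.inl b.ind.range)

theorem smallPolytopeGraph_adj_of_delete {P Q : smallPolytopes G} {v : Fin d → ℝ}
    (hv : v ∈ vertexSet P.1.1.1) (hQ : Q.1.1.1 = convexHull ℝ (vertexSet P.1.1.1 \ {v})) :
    (smallPolytopeGraph G).Adj P Q := by
  have hne : P.1.1 ≠ Q.1.1 := fun h =>
    convexIndependent_set_iff_notMem_convexHull_sdiff.1
      (convexIndependent_vertexSet P.1.1.2.1) v hv (hQ ▸ h ▸ extremePoints_subset hv)
  exact ⟨hne, .inl (.inr ⟨v, ⟨hv, hQ ▸ Q.1.1.2.2⟩, hQ⟩)⟩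

/-- Both simplices arise by deleting a vertex of the convex hull of the first one and the inserted
point. -/
theorem reachable_of_exchange {b b' : AffineBasis (Fin (d + 1)) ℝ (Fin d → ℝ)}
    (h : Exchange G b b') (hb : range b ⊆ G) {P Q : smallPolytopes G}
    (hP : P.1.1.1 = convexHull ℝ (range b)) (hQ : Q.1.1.1 = convexHull ℝ (range b')) :
    (smallPolytopeGraph G).Reachable P Q := by
  obtain ⟨x, hxG, hxb, hind, s, hb'⟩ := h
  have hfin : (insert x (range b)).Finite := (finite_range b).insert x
  have hspan : affineSpan ℝ (insert x (range b)) = ⊤ :=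
    top_le_iff.1 (b.tot.symm.le.trans (affineSpan_mono ℝ (subset_insert x _)))
  have hcard : (insert x (range b)).ncard = d + 2 := by
    rw [ncard_insert_of_notMem hxb, ncard_range_of_injective b.ind.injective, Nat.card_fin]
  obtain ⟨R, hR⟩ := exists_smallPolytope hfin hind (insert_subset hxG hb) hspan (.inr hcard)
  have hvert : vertexSet R.1.1.1 = insert x (range b) := by
    rw [hR, vertexSet_convexHull hfin hind]
  have hbx : range b = insert x (range b) \ {x} := (insert_sdiff_self_of_notMem hxb).symm
  have hb'x : range b' = insert x (range b) \ {b s} := by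
    rw [hb', range_update b.ind.injective, insert_sdiff_of_notMem]
    rintro rfl
    exact hxb ⟨s, rfl⟩
  have hRP : (smallPolytopeGraph G).Adj R P :=
    smallPolytopeGraph_adj_of_delete (v := x) (by simp [hvert]) (by rw [hvert, ← hbx, hP])
  have hRQ : (smallPolytopeGraph G).Adj R Q :=
    smallPolytopeGraph_adj_of_delete (v := b s) (by simp [hvert]) (by rw [hvert, ← hb'x, hQ])
  exact hRP.symm.reachable.trans hRQ.reachable

theorem reachable_of_reflTransGen_exchange {b b' : AffineBasis (Fin (d + 1)) ℝ (Fin d → ℝ)}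
    (h : ReflTransGen (Exchange G) b b') (hb : range b ⊆ G) {P Q : smallPolytopes G}
    (hP : P.1.1.1 = convexHull ℝ (range b)) (hQ : Q.1.1.1 = convexHull ℝ (range b')) :
    (smallPolytopeGraph G).Reachable P Q := by
  induction h generalizing Q with
  | refl =>
    obtain rfl : P = Q := Subtype.ext (Subtype.ext (Subtype.ext (hP.trans hQ.symm)))
    rfl
  | tail hbc hcb' ih =>
    have hc := range_subset_of_reflTransGen_exchange hbc hb
    obtain ⟨R, hR⟩ := exists_smallPolytope_eq_convexHull_range _ hc
    exact (ih hR).trans (reachable_of_exchange hcb' hc hR hQ)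

theorem exists_reachable_convexHull_range (P : smallPolytopes G) :
    ∃ b : AffineBasis (Fin (d + 1)) ℝ (Fin d → ℝ), range b ⊆ G ∧ ∃ Q : smallPolytopes G,
      Q.1.1.1 = convexHull ℝ (range b) ∧ (smallPolytopeGraph G).Reachable P Q := by
  have hhull := convexHull_vertexSet P.1.1.2.1
  have hspan : affineSpan ℝ (vertexSet P.1.1.1) = ⊤ := by
    rw [← affineSpan_convexHull, hhull]
    exact P.1.1.2.2
  obtain ⟨b, hb⟩ := exists_affineBasis_range_subset (Module.finrank_fin_fun ℝ) hspan
  have hbG : range b ⊆ G := hb.trans P.1.2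
  refine ⟨b, hbG, ?_⟩
  rcases P.2 with hsimplex | hcard
  · refine ⟨P, ?_, .refl P⟩
    rw [eq_of_subset_of_affineSpan_eq_top hsimplex hb b.tot, hhull]
  · obtain ⟨v, hv⟩ : ∃ v, vertexSet P.1.1.1 \ range b = {v} := by
      rw [← ncard_eq_one, ncard_sdiff hb, hcard, ncard_range_of_injective b.ind.injective,
        Nat.card_fin, Nat.add_sub_add_left]
    have hvP : v ∈ vertexSet P.1.1.1 := (hv.symm.subset rfl).1
    have hrange : vertexSet P.1.1.1 \ {v} = range b := by
      rw [← hv, sdiff_sdiff_cancel_left hb]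
    obtain ⟨Q, hQ⟩ := exists_smallPolytope_eq_convexHull_range b hbG
    exact ⟨Q, hQ, (smallPolytopeGraph_adj_of_delete hvP (hrange ▸ hQ)).reachable⟩

theorem exists_reachable_range_subset_corners (hd : 2 ≤ d) {lo hi : Fin d → ℝ}
    (hG : IsBoxGrid lo hi G) (P : smallPolytopes G) :
    ∃ b : AffineBasis (Fin (d + 1)) ℝ (Fin d → ℝ), range b ⊆ corners lo hi ∧
      ∃ Q : smallPolytopes G, Q.1.1.1 = convexHull ℝ (range b) ∧
        (smallPolytopeGraph G).Reachable P Q := by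
  obtain ⟨b, hb, Q, hQ, hPQ⟩ := exists_reachable_convexHull_range P
  have hcard : 3 ≤ ENat.card (Fin (d + 1)) := by
    rw [ENat.card_eq_coe_fintype_card, Fintype.card_fin]
    exact_mod_cast Nat.succ_le_succ hd
  obtain ⟨b', hb', h⟩ := exists_reflTransGen_range_subset_corners hcard hG b hb
  obtain ⟨Q', hQ'⟩ := exists_smallPolytope_eq_convexHull_range b' (hb'.trans hG.corners_subset)
  exact ⟨b', hb', Q', hQ', hPQ.trans (reachable_of_reflTransGen_exchange h hb hQ hQ')⟩

theorem reachable_of_range_subset_corners {lo hi : Fin d → ℝ} (hG : IsBoxGrid lo hi G)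
    {b c : AffineBasis (Fin (d + 1)) ℝ (Fin d → ℝ)} (hb : range b ⊆ corners lo hi)
    (hc : range c ⊆ corners lo hi) {P Q : smallPolytopes G}
    (hP : P.1.1.1 = convexHull ℝ (range b)) (hQ : Q.1.1.1 = convexHull ℝ (range c)) :
    (smallPolytopeGraph G).Reachable P Q := by
  obtain ⟨b', hb', h⟩ := exists_reflTransGen_exchange_range_eq
    (convexIndependent_corners fun i => (hG.lt i).le) hG.corners_subset b c hb hc
  exact reachable_of_reflTransGen_exchange h (hb.trans hG.corners_subset) hP (hb' ▸ hQ)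

/-- The points of the integer lattice in the hypercube `[0,k]^d`. -/
def latticePointsInCube (d k : ℕ) : Set (Fin d → ℝ) :=
  {x ∈ cube d k | ∀ i, ∃ z : ℤ, x i = z}

theorem isBoxGrid_latticePointsInCube (d : ℕ) {k : ℕ} (hk : 0 < k) :
    IsBoxGrid (fun _ => 0) (fun _ => (k : ℝ)) (latticePointsInCube d k) where
  lt _ := Nat.cast_pos.2 hk
  nonempty := ⟨0, fun _ => ⟨le_rfl, k.cast_nonneg⟩, fun _ => ⟨0, by simp⟩⟩
  subset_Icc _ hx := ⟨fun i => (hx.1 i).1, fun i => (hx.1 i).2⟩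
  update_mem x hx i c hc := by
    have hcube : 0 ≤ c ∧ c ≤ k := by rcases hc with rfl | rfl <;> simp
    have hinteger : ∃ z : ℤ, c = z := by
      rcases hc with rfl | rfl
      exacts [⟨0, by simp⟩, ⟨k, by simp⟩]
    exact ⟨forall_update_iff x (fun _ t => 0 ≤ t ∧ t ≤ k) |>.2 ⟨hcube, fun j _ => hx.1 j⟩,
      forall_update_iff x (fun _ t => ∃ z : ℤ, t = z) |>.2 ⟨hinteger, fun j _ => hx.2 j⟩⟩

theorem latticePolytopesInCube_eq (d k : ℕ) :
    latticePolytopesInCube d k = polytopesOn (latticePointsInCube d k) := by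
  have hconv : Convex ℝ (cube d k) := by
    have : cube d k = Icc (fun _ => 0) fun _ => (k : ℝ) := by
      ext x
      simp [cube, Pi.le_def, forall_and]
    exact this ▸ convex_Icc _ _
  ext P
  refine ⟨fun h v hv => ⟨h.2 (extremePoints_subset hv), h.1 v hv⟩, fun h => ?_⟩
  refine ⟨fun v hv => (h hv).2, ?_⟩
  rw [← convexHull_vertexSet P.2.1]
  exact convexHull_min (fun v hv => (h hv).1) hconv

end Polytope

end ElementaryMoves

open ElementaryMoves in
theorem theorem2_general {d : ℕ} (hd : 2 ≤ d) {lo hi : Fin d → ℝ} {G : Set (Fin d → ℝ)}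
    (hG : IsBoxGrid lo hi G) : (smallPolytopeGraph G).Connected := by
  refine (SimpleGraph.connected_iff _).2 ⟨fun P Q => ?_, ?_⟩
  · obtain ⟨b, hb, P', hP', hPP'⟩ := exists_reachable_range_subset_corners hd hG P
    obtain ⟨c, hc, Q', hQ', hQQ'⟩ := exists_reachable_range_subset_corners hd hG Q
    exact hPP'.trans ((reachable_of_range_subset_corners hG hb hc hP' hQ').trans hQQ'.symm)
  · obtain ⟨b, hb⟩ := exists_affineBasis_range_subset (Module.finrank_fin_fun ℝ)
      (affineSpan_corners hG.lt)
    obtain ⟨P, -⟩ := exists_smallPolytope_eq_convexHull_range b (hb.trans hG.corners_subset)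
    exact ⟨P⟩

theorem theorem2 (d k : ℕ) (hd : 2 ≤ d) (hk : 0 < k) :
    ((ElementaryMoves.latticeMoveGraph d k).induce
      {P | ElementaryMoves.IsSimplex P.1.1 ∨
        (ElementaryMoves.vertexSet P.1.1).ncard = d + 2}).Connected := by
  rw [ElementaryMoves.latticeMoveGraph, ElementaryMoves.latticePolytopesInCube_eq]
  exact theorem2_general hd (ElementaryMoves.isBoxGrid_latticePointsInCube d hk)
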